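/- Let $\Sigma,\Gamma$ be finite alphabets. A (subsequential) transducer $\mathcal M$ has a finite state set $Q$ containing an initial state, an initial production in $\Gamma^*$, a partial transition function $Q\times\Sigma\to Q\times\Gamma^*$ and a partial final output function $Q\to\Gamma^*$; $[\![\mathcal M]\!]$ is the partial function $\Sigma^*\to\Gamma^*$ it implements. Let $\tau:\Sigma^*\to\Gamma^*$ be a partial function implemented by some transducer, and let $\mathcal A$ be a DFA whose language $\mathit{Up}$ satisfies $\mathrm{dom}(\tau)\subseteq \mathit{Up}$. The algorithm MinTransducerUp maintains sets $P,S\subseteq\Sigma^*$, initially $P=S=\{\varepsilon\}$, and the observation table $T$ on $(P\cup P\Sigma)\cdot S$ given by $T(w)=\#$ if $w\notin\mathit{Up}$, $T(w)=\bot$ if $w\in\mathit{Up}\setminus\mathrm{dom}(\tau)$, and $T(w)=\tau(w)$ otherwise. A transducer $\mathcal M$ is compatible with $T$ if, for all $w\in(P\cup P\Sigma)\cdot S$, $T(w)\in\Gamma^*$ implies $[\![\mathcal M]\!](w)=T(w)$ and $T(w)=\bot$ implies $w\notin\mathrm{dom}([\![\mathcal M]\!])$; "minimal" means with the least number of states.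 For $u\in P\cup P\Sigma$ let $\mathrm{lcp}_T(u)$ be the longest common prefix of the words $T(uv)\in\Gamma^*$, $v\in S$ (undefined if there are none). Rows $u,u'$ agree in column $v\in S$ if $T(uv)=\bot\iff T(u'v)=\bot$ and, whenever one of $T(uv),T(u'v)$ is in $\Gamma^*$, so is the other and $\mathrm{lcp}_T(u)^{-1}T(uv)=\mathrm{lcp}_T(u')^{-1}T(u'v)$; write $u\equiv_T u'$ if they agree in all columns. (In $\mathrm{lcp}_T$ and $\equiv_T$, the entry $\#$ is either kept as a separate symbol or everywhere replaced by $\bot$; the theorem holds for both conventions.) Each iteration of the main loop performs the first of the following actions that applies: 1. if for some $u\in P$, $a\in\Sigma$, $v,v'\in S$ with $T(uav),T(uav')\in\Gamma^*$, $\mathrm{lcp}_T(u)$ is undefined or not a common prefix of $T(uav)$ and $T(uav')$, add $av,av'$ to $S$; 2. if for some $u,u'\in P$ with $u\equiv_T u'$, $a\in\Sigma$ and $v\in S$, the rows $ua,u'a$ do not agree in column $v$, add $av$ to $S$; 3. if for some $u\in P$, $a\in\Sigma$ there is no $u'\in P$ with $ua\equiv_T u'$, add $ua$ to $P$; 4.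 if two minimal transducers compatible with $T$ differ on some $u\in\mathit{Up}$ (such a $u$ is the answer of the subroutine CompetingMinGen), add $u$ and all its suffixes to $S$; 5. otherwise take a minimal transducer $\mathcal M$ compatible with $T$ (the answer of the subroutine MinGen) and pose an equivalence query on the product $\mathcal A\times\mathcal M$, which implements $[\![\mathcal M]\!]_{|\mathit{Up}}$; if the teacher returns a word $u$ on which this function differs from $\tau$, add all suffixes of $u$ to $S$; if the teacher answers that it equals $\tau$, return $\mathcal M$. **Theorem.** Whatever the choices of witnesses, the (correct) answers of the subroutines and the (correct) answers of the teacher, the algorithm MinTransducerUp terminates: it has no infinite execution, and every execution ends by returning a transducer $\mathcal M$ with $[\![\mathcal M]\!]_{|\mathit{Up}}=\tau$. The number of equivalence queries it makes, including the last one, is at most the number of states of a minimal transducer $\mathcal M$ such that $[\![\mathcal M]\!]_{|\mathit{Up}}=\tau$. -/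

import Mathlib

namespace Graybox

/-- Subsequential string transducers with input alphabet `α`, output alphabet `β` and state set `Q`
(finite wherever it is used): initial state, initial production, partial transition function,
partial final function. -/
structure Transducer (α β Q : Type*) where
  start : Q
  init : List β
  step : Q → α → Option (Q × List β)
  final : Q → Option (List β)

namespace Transducer

variable {α β Q : Type*}

/-- `M.run q u = some (q', w)` iff reading `u` from `q` leads to `q'` with output `w`. -/
def run (M : Transducer α β Q) : Q → List α → Option (Q × List β)
  | q, [] => some (q, [])
  | q, a :: u => (M.step q a).bind fun t => (M.run t.1 u).map fun r => (r.1, t.2 ++ r.2)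

/-- The partial function implemented by a transducer. -/
def sem (M : Transducer α β Q) (u : List α) : Option (List β) :=
  (M.run M.start u).bind fun r => (M.final r.1).map fun w => M.init ++ r.2 ++ w

open Classical in
/-- The restriction of the partial function of `M` to the language `L`. -/
noncomputable def semOn (M : Transducer α β Q) (L : Language α) (u : List α) :
    Option (List β) :=
  if u ∈ L then M.sem u else none

open Classical in
/-- The product of a transducer with a DFA; a pair is final iff both components are. -/
noncomputable def prod {σ : Type*} (M : Transducer α β Q) (A : DFA α σ) :
    Transducer α β (Q × σ) where
  start := (M.start, A.start)
  init := M.init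
  step := fun x a => (M.step x.1 a).map fun t => ((t.1, A.step x.2 a), t.2)
  final := fun x => if x.2 ∈ A.accept then M.final x.1 else none

end Transducer

/-- Entries of an observation table: an output word, `⊥`, or `#`. -/
inductive Entry (β : Type*) where
  | word (w : List β)
  | bot
  | hash

variable {α β : Type*}

open Classical in
/-- The value that the table invariant prescribes at the input word `w`: `#` outside `Up`, `⊥` in
`Up` outside the domain of `τ`, and `τ w` otherwise. -/
noncomputable def observe (Up : Language α) (τ : List α → Option (List β)) (w : List α) :
    Entry β :=
  if w ∈ Up then
    match τ w with
    | some x => .word x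
    | none => .bot
  else .hash

/-- The row index set `P ∪ P·Σ`. -/
def rows (P : Set (List α)) : Set (List α) :=
  P ∪ {w | ∃ u ∈ P, ∃ a : α, w = u ++ [a]}

/-- `M` is compatible with the observation table with index sets `P`, `S` and entries `T`. -/
def Compatible {Q : Type*} (T : List α → Entry β) (P S : Set (List α))
    (M : Transducer α β Q) : Prop :=
  ∀ u ∈ rows P, ∀ v ∈ S,
    (∀ x, T (u ++ v) = .word x → M.sem (u ++ v) = some x) ∧
    (T (u ++ v) = .bot → M.sem (u ++ v) = none)

/-- `M` has the least number of states among the transducers compatible with the table. -/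
def MinCompatible (T : List α → Entry β) (P S : Set (List α)) {n : ℕ}
    (M : Transducer α β (Fin n)) : Prop :=
  Compatible T P S M ∧
    ∀ (m : ℕ) (N : Transducer α β (Fin m)), Compatible T P S N → n ≤ m

/-- The output words that occur in row `u`. -/
def rowWords (T : List α → Entry β) (S : Set (List α)) (u : List α) : Set (List β) :=
  {x | ∃ v ∈ S, T (u ++ v) = .word x}

/-- `p` is the longest common prefix of the output words in row `u`. There is none if the row
holds no output word. -/
def IsLcp (T : List α → Entry β) (S : Set (List α)) (u : List α) (p : List β) : Prop :=
  (rowWords T S u).Nonempty ∧ (∀ x ∈ rowWords T S u, p <+: x) ∧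
    ∀ q : List β, (∀ x ∈ rowWords T S u, q <+: x) → q <+: p

/-- Rows `u` and `u'` agree in column `v`: `⊥` occurs in both or in neither, and if one entry is an
output word then so is the other, and they are the same after removal of the longest common
prefixes of the two rows. -/
def AgreeAt (T : List α → Entry β) (S : Set (List α)) (u u' v : List α) : Prop :=
  (T (u ++ v) = .bot ↔ T (u' ++ v) = .bot) ∧
    (((∃ x, T (u ++ v) = .word x) ∨ (∃ x, T (u' ++ v) = .word x)) →
      ∃ p p' r : List β, IsLcp T S u p ∧ IsLcp T S u' p' ∧
        T (u ++ v) = .word (p ++ r) ∧ T (u' ++ v) = .word (p' ++ r))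

/-- The equivalence of rows. -/
def RowEquiv (T : List α → Entry β) (S : Set (List α)) (u u' : List α) : Prop :=
  ∀ v ∈ S, AgreeAt T S u u' v

/-- `(u, a, v, v')` witnesses that the longest common prefix of row `u` is not a prefix of that of
row `ua`: it is undefined, or not a common prefix of the entries of row `ua` in columns
`v`, `v'`. -/
def LcpWitness (T : List α → Entry β) (P S : Set (List α))
    (u : List α) (a : α) (v v' : List α) : Prop :=
  u ∈ P ∧ v ∈ S ∧ v' ∈ S ∧ ∃ x x' : List β,
    T (u ++ [a] ++ v) = .word x ∧ T (u ++ [a] ++ v') = .word x' ∧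
    ∀ p, IsLcp T S u p → ¬ (p <+: x ∧ p <+: x')

/-- `(u, u', a, v)`: rows `u` and `u'` are equivalent, rows `ua` and `u'a` differ in
column `v`. -/
def EquivWitness (T : List α → Entry β) (P S : Set (List α))
    (u u' : List α) (a : α) (v : List α) : Prop :=
  u ∈ P ∧ u' ∈ P ∧ v ∈ S ∧ RowEquiv T S u u' ∧ ¬ AgreeAt T S (u ++ [a]) (u' ++ [a]) v

/-- `ua` witnesses non-closure: row `ua` is equivalent to no row of `P`. -/
def ClosureWitness (T : List α → Entry β) (P S : Set (List α)) (u : List α) (a : α) : Prop :=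
  u ∈ P ∧ ∀ u' ∈ P, ¬ RowEquiv T S (u ++ [a]) u'

/-- The table is closed, equivalence-consistent and lcp-consistent. -/
def Saturated (T : List α → Entry β) (P S : Set (List α)) : Prop :=
  (¬ ∃ u a v v', LcpWitness T P S u a v v') ∧
  (¬ ∃ u u' a v, EquivWitness T P S u u' a v) ∧
  (¬ ∃ u a, ClosureWitness T P S u a)

/-- `u` is a possible answer of CompetingMinGen: a word of `Up` on which two minimal transducers
compatible with the table differ. -/
def CompetingWord (Up : Language α) (T : List α → Entry β) (P S : Set (List α))
    (u : List α) : Prop :=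
  u ∈ Up ∧ ∃ (n : ℕ) (M₁ M₂ : Transducer α β (Fin n)),
    MinCompatible T P S M₁ ∧ MinCompatible T P S M₂ ∧ M₁.sem u ≠ M₂.sem u

/-- The treatment of `#` when rows are compared: with `merge = true` it is replaced by `⊥`, with
`merge = false` it is a symbol of its own. -/
def rowView (merge : Bool) : Entry β → Entry β
  | .hash => if merge then .bot else .hash
  | e => e

/-- Configurations of the algorithm, with the number `k` of equivalence queries made so far: at the
head of the main loop with index sets `P` and `S`, or halted with result `M`. -/
inductive Config (α β : Type*) where
  | loop (P S : Set (List α)) (k : ℕ)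
  | halt (n : ℕ) (M : Transducer α β (Fin n)) (k : ℕ)

/-- The number of equivalence queries made so far. -/
def Config.queries : Config α β → ℕ
  | .loop _ _ k => k
  | .halt _ _ k => k

/-- The initial configuration, `P = S = {ε}`. -/
def Config.initial (α β : Type*) : Config α β := .loop {[]} {[]} 0

/-- One iteration of the main loop, for the DFA `A` of the upper bound and the target `τ`. The
choice of witnesses, the answers of the two minimal generation subroutines and the counterexamples
of the teacher are arbitrary among the correct ones. -/
inductive Step {σ : Type*} (A : DFA α σ) (τ : List α → Option (List β)) (merge : Bool) :
    Config α β → Config α β → Prop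
  | lcp {P S : Set (List α)} {k : ℕ} {u : List α} {a : α} {v v' : List α}
      (h : LcpWitness (rowView merge ∘ observe A.accepts τ) P S u a v v') :
      Step A τ merge (.loop P S k) (.loop P (S ∪ {a :: v, a :: v'}) k)
  | equiv {P S : Set (List α)} {k : ℕ} {u u' : List α} {a : α} {v : List α}
      (h₁ : ¬ ∃ u a v v', LcpWitness (rowView merge ∘ observe A.accepts τ) P S u a v v')
      (h : EquivWitness (rowView merge ∘ observe A.accepts τ) P S u u' a v) :
      Step A τ merge (.loop P S k) (.loop P (S ∪ {a :: v}) k)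
  | closure {P S : Set (List α)} {k : ℕ} {u : List α} {a : α}
      (h₁ : ¬ ∃ u a v v', LcpWitness (rowView merge ∘ observe A.accepts τ) P S u a v v')
      (h₂ : ¬ ∃ u u' a v, EquivWitness (rowView merge ∘ observe A.accepts τ) P S u u' a v)
      (h : ClosureWitness (rowView merge ∘ observe A.accepts τ) P S u a) :
      Step A τ merge (.loop P S k) (.loop (P ∪ {u ++ [a]}) S k)
  | competing {P S : Set (List α)} {k : ℕ} {u : List α}
      (h₁ : Saturated (rowView merge ∘ observe A.accepts τ) P S)
      (h : CompetingWord A.accepts (observe A.accepts τ) P S u) :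
      Step A τ merge (.loop P S k) (.loop P (S ∪ {s | s <:+ u}) k)
  | counterexample {P S : Set (List α)} {k n : ℕ} {M : Transducer α β (Fin n)} {u : List α}
      (h₁ : Saturated (rowView merge ∘ observe A.accepts τ) P S)
      (h₂ : ¬ ∃ w, CompetingWord A.accepts (observe A.accepts τ) P S w)
      (hM : MinCompatible (observe A.accepts τ) P S M)
      (h : (M.prod A).sem u ≠ τ u) :
      Step A τ merge (.loop P S k) (.loop P (S ∪ {s | s <:+ u}) (k + 1))
  | success {P S : Set (List α)} {k n : ℕ} {M : Transducer α β (Fin n)}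
      (h₁ : Saturated (rowView merge ∘ observe A.accepts τ) P S)
      (h₂ : ¬ ∃ w, CompetingWord A.accepts (observe A.accepts τ) P S w)
      (hM : MinCompatible (observe A.accepts τ) P S M)
      (h : (M.prod A).sem = τ) :
      Step A τ merge (.loop P S k) (.halt n M (k + 1))

end Graybox

/-! Correctness on stopping is immediate, since the teacher certifies the result and a transducer
for `τ` is compatible with every table, so the loop is never stuck.

Query bound: when an equivalence query is posed, all minimal compatible transducers agree on the
upper bound. A counterexample therefore refutes all of them at once, and the minimal compatible size
strictly increases. That size is always at most the size of any transducer correct on the upper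
bound (`Good.counterexample`).

Termination: distinct words of `P` have inequivalent rows, whereas words reaching the same state of
a target transducer and of `A` have equivalent rows. Hence `P` stabilises, and equivalence
consistency never fails. With `P` finite, the row prefixes can only shrink, so lcp repairs stop as
well. From then on every iteration adds a word refuting some minimal compatible transducer
(`Step.progress`).

It remains to exclude an infinite sequence of such refutations. State counts are bounded by the
target's, but output labels are not, so counting does not suffice; compactness replaces it
(`not_eventually_separated`). Along an ultrafilter on the indices, each label is either constant or
of unbounded length. A late transducer is correct on an earlier word `w i`, so it uses no label
longer than `τ (w i)` there. All labels it uses are then the constant ones, which the transducer of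
index `i` shares, so that one is correct on `w i` too: a contradiction. -/

open Filter

namespace Graybox

variable {α β σ : Type*}

/-! ### Runs of transducers and products with automata -/

section Run

variable {Q : Type*}

theorem Transducer.run_append (M : Transducer α β Q) (q : Q) (u v : List α) :
    M.run q (u ++ v) =
      (M.run q u).bind fun t => (M.run t.1 v).map fun r => (r.1, t.2 ++ r.2) := by
  induction u generalizing q with
  | nil => simp [Transducer.run]
  | cons a u ih =>
    simp only [List.cons_append, Transducer.run]
    cases M.step q a with
    | none => rfl
    | some t =>
      simp only [Option.bind_some, ih]
      cases M.run t.1 u with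
      | none => rfl
      | some t' =>
        simp only [Option.bind_some, Option.map_some]
        cases M.run t'.1 v <;> simp

theorem Transducer.prod_run (M : Transducer α β Q) (A : DFA α σ) (q : Q) (s : σ) (u : List α) :
    (M.prod A).run (q, s) u =
      (M.run q u).map fun r => ((r.1, A.evalFrom s u), r.2) := by
  induction u generalizing q s with
  | nil => simp [Transducer.run]
  | cons a u ih =>
    simp only [Transducer.run, Transducer.prod, DFA.evalFrom_cons] at ih ⊢
    cases M.step q a with
    | none => rfl
    | some t =>
      simp only [Option.map_some, Option.bind_some, ih]
      cases M.run t.1 u <;> simp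

theorem Transducer.prod_sem (M : Transducer α β Q) (A : DFA α σ) :
    (M.prod A).sem = M.semOn A.accepts := by
  classical
  funext u
  have h := M.prod_run A M.start A.start u
  have hmem : u ∈ A.accepts ↔ A.evalFrom A.start u ∈ A.accept := Iff.rfl
  simp only [Transducer.sem, Transducer.semOn, hmem]
  change (((M.prod A).run (M.start, A.start) u).bind _) = _
  rw [h]
  cases M.run M.start u with
  | none => simp
  | some r =>
    by_cases hu : A.evalFrom A.start u ∈ A.accept <;> simp [Transducer.prod, hu]

end Run

/-! ### Compactness of transducers with a fixed state set -/

section Compactness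

variable {κ Q : Type*}

/-- Two optional labelled words are equal, or carry the same label and the second word is longer
than `L`. -/
def Approx (L : ℕ) (s t : Option (κ × List β)) : Prop :=
  s = t ∨ ∃ q x y, s = some (q, x) ∧ t = some (q, y) ∧ L < y.length

theorem eventually_eq_const_of_finite {ι X : Type*} (U : Ultrafilter ι) {f : ι → X} {s : Set X}
    (hs : s.Finite) (h : ∀ᶠ i in U, f i ∈ s) : ∃ x, ∀ᶠ i in U, f i = x := by
  have h' : (⋃ x ∈ s, f ⁻¹' {x}) ∈ U := by
    filter_upwards [h] with i hi
    simpa using hi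
  obtain ⟨x, -, hx⟩ := (Ultrafilter.finite_biUnion_mem_iff hs).1 h'
  exact ⟨x, hx⟩

/-- If lengths are bounded along `U`, only finitely many values occur and one of them is taken
`U`-often. Otherwise lengths exceed every `L` along `U`, while the label still ranges over a finite
set and is constant. -/
theorem eventually_approx [Finite κ] [Finite β] {ι : Type*} (U : Ultrafilter ι)
    (f : ι → Option (κ × List β)) :
    ∀ᶠ i in U, ∀ L, ∀ᶠ j in U, Approx L (f i) (f j) := by
  by_cases hb : ∃ L : ℕ, ∀ᶠ j in U, ∀ p ∈ f j, p.2.length ≤ L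
  · obtain ⟨L, hL⟩ := hb
    have hfin : (insert none (some '' (Set.univ ×ˢ {x : List β | x.length ≤ L})) :
        Set (Option (κ × List β))).Finite :=
      ((Set.finite_univ.prod (List.finite_length_le β L)).image _).insert _
    obtain ⟨t, ht⟩ := eventually_eq_const_of_finite U (f := f) hfin (by
      filter_upwards [hL] with j hj
      cases hfj : f j with
      | none => simp
      | some p =>
        refine Or.inr ⟨p, ⟨trivial, hj p (by simp [hfj])⟩, rfl⟩)
    filter_upwards [ht] with i hi L
    filter_upwards [ht] with j hj
    exact Or.inl (hi.trans hj.symm)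
  · push Not at hb
    obtain ⟨s, hs⟩ := eventually_eq_const_of_finite U (f := fun i => (f i).map Prod.fst)
      Set.finite_univ (Eventually.of_forall fun _ => Set.mem_univ _)
    filter_upwards [hs] with i hi L
    filter_upwards [hs, hb L] with j hj hlong
    obtain ⟨⟨q, y⟩, hy, hlen⟩ := hlong
    have hy' : f j = some (q, y) := hy
    rw [hy'] at hj
    rw [← hj] at hi
    obtain ⟨⟨q', x⟩, hx, hq⟩ := Option.map_eq_some_iff.1 hi
    obtain rfl : q' = q := hq
    exact Or.inr ⟨q', x, y, hx, hy', hlen⟩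

theorem approx_run {L : ℕ} {M N : Transducer α β Q}
    (h : ∀ q a, Approx L (M.step q a) (N.step q a)) (q : Q) (u : List α) :
    Approx L (M.run q u) (N.run q u) := by
  induction u generalizing q with
  | nil => exact Or.inl rfl
  | cons a u ih =>
    simp only [Transducer.run]
    rcases h q a with h | ⟨q', x, y, hx, hy, hlen⟩
    · rw [h]
      cases N.step q a with
      | none => exact Or.inl rfl
      | some t =>
        simp only [Option.bind_some]
        rcases ih t.1 with h' | ⟨q₁, x₁, y₁, hx₁, hy₁, hlen₁⟩
        · exact Or.inl (by rw [h'])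
        · exact Or.inr ⟨q₁, t.2 ++ x₁, t.2 ++ y₁, by simp [hx₁], by simp [hy₁],
            by simp; omega⟩
    · rw [hx, hy]
      simp only [Option.bind_some]
      rcases ih q' with h' | ⟨q₁, x₁, y₁, hx₁, hy₁, hlen₁⟩
      · rw [h']
        cases N.run q' u with
        | none => exact Or.inl rfl
        | some r => exact Or.inr ⟨r.1, x ++ r.2, y ++ r.2, rfl, rfl, by simp; omega⟩
      · exact Or.inr ⟨q₁, x ++ x₁, y ++ y₁, by simp [hx₁], by simp [hy₁], by simp; omega⟩

/-- Approximation preserves definedness and target states, so only outputs can differ. An output of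
`N` of length at most `L` contains no factor longer than `L`, which forces every factor used to be
equal in `M`. -/
theorem sem_eq_of_approx {L : ℕ} {M N : Transducer α β Q} (hstart : M.start = N.start)
    (hinit : Approx L (some ((), M.init)) (some ((), N.init)))
    (hstep : ∀ q a, Approx L (M.step q a) (N.step q a))
    (hfinal : ∀ q, Approx L ((M.final q).map (Prod.mk ())) ((N.final q).map (Prod.mk ())))
    {w : List α} (hw : ∀ c, N.sem w = some c → c.length ≤ L) : M.sem w = N.sem w := by
  unfold Transducer.sem at hw ⊢
  have hrun := approx_run hstep N.start w
  rw [hstart]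
  cases hN : N.run N.start w with
  | none =>
    rcases hrun with h | ⟨q, x, y, hx, hy, -⟩
    · simp [h, hN]
    · simp [hN] at hy
  | some r =>
    obtain ⟨q, y⟩ := r
    have hrun' : ∃ x, M.run N.start w = some (q, x) ∧ (x = y ∨ L < y.length) := by
      rcases hrun with h | ⟨q', x, y', hx, hy, hlen⟩
      · exact ⟨y, h.trans hN, Or.inl rfl⟩
      · rw [hN] at hy
        obtain ⟨rfl, rfl⟩ : q = q' ∧ y = y' := by simpa using hy
        exact ⟨x, hx, Or.inr hlen⟩
    obtain ⟨x, hx, hxy⟩ := hrun'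
    simp only [hx, hN, Option.bind_some] at hw ⊢
    have hf := hfinal q
    cases hNf : N.final q with
    | none =>
      rcases hf with h | ⟨_, _, _, _, h, _⟩
      · rw [hNf] at h
        simp at h
        simp [h]
      · simp [hNf] at h
    | some z =>
      have hle := hw _ (by rw [hNf]; rfl)
      simp only [List.length_append] at hle
      obtain rfl : x = y := hxy.resolve_right (by omega)
      have hi : M.init = N.init := by
        rcases hinit with h | ⟨_, _, _, _, h, hl⟩
        · simpa using h
        · simp at h
          subst h
          omega
      rcases hf with h | ⟨_, _, y', _, h, hl⟩
      · rw [hNf] at h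
        simp only [Option.map_some, Option.map_eq_some_iff, Prod.mk.injEq, true_and] at h
        obtain ⟨_, h, rfl⟩ := h
        rw [h, hi]
      · simp [hNf] at h
        subst h
        omega

/-- Transducers over a fixed finite state set that are correct on ever more words of a sequence are
eventually correct on the next word too. -/
theorem not_eventually_separated [Finite α] [Finite β] [Finite Q] (U : Ultrafilter ℕ)
    (hU : (U : Filter ℕ) ≤ atTop) (τ : List α → Option (List β)) (w : ℕ → List α)
    (M : ℕ → Transducer α β Q) :
    ¬ ∀ᶠ i in U, (∀ j < i, (M i).sem (w j) = τ (w j)) ∧ (M i).sem (w i) ≠ τ (w i) := by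
  intro h
  obtain ⟨q₀, hq₀⟩ := eventually_eq_const_of_finite U (f := fun i => (M i).start)
    Set.finite_univ (Eventually.of_forall fun _ => Set.mem_univ _)
  have hstep : ∀ᶠ i in U, ∀ q a, ∀ L, ∀ᶠ j in U, Approx L ((M i).step q a) ((M j).step q a) :=
    eventually_all.2 fun q => eventually_all.2 fun a => eventually_approx U _
  have hfinal : ∀ᶠ i in U, ∀ q, ∀ L, ∀ᶠ j in U,
      Approx L (((M i).final q).map (Prod.mk ())) (((M j).final q).map (Prod.mk ())) :=
    eventually_all.2 fun q => eventually_approx U _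
  have hinit := eventually_approx U fun i => some ((), (M i).init)
  -- The index `i` is fixed before `L`, because `L` depends on `w i`; hence the quantifier over `L`
  -- inside the eventual statements.
  obtain ⟨i, hi, hqi, hs, hf, hn⟩ := (h.and (hq₀.and (hstep.and (hfinal.and hinit)))).exists
  obtain ⟨L, hL⟩ : ∃ L, ∀ c, τ (w i) = some c → c.length ≤ L := by
    cases τ (w i) with
    | none => exact ⟨0, by simp⟩
    | some c => exact ⟨c.length, by simp⟩
  obtain ⟨j, hj, hij, hqj, hs', hf', hn'⟩ := (h.and (((eventually_gt_atTop i).filter_mono hU).and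
    (hq₀.and ((eventually_all.2 fun q => eventually_all.2 fun a => hs q a L).and
      ((eventually_all.2 fun q => hf q L).and (hn L)))))).exists
  have hτ := hj.1 i hij
  refine hi.2 ?_
  rw [← hτ]
  exact sem_eq_of_approx (hqi.trans hqj.symm) hn' hs' hf' (by rwa [hτ])

end Compactness

/-! ### Longest common prefixes of rows and their descent -/

section Lcp

/-- A nonempty set of words has a longest common prefix. -/
theorem exists_lcp {X : Set (List β)} (hX : X.Nonempty) :
    ∃ p : List β, (∀ x ∈ X, p <+: x) ∧ ∀ q : List β, (∀ x ∈ X, q <+: x) → q <+: p := by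
  classical
  -- Every common prefix is a prefix of `x₀`, so the longest one is found by its length.
  obtain ⟨x₀, hx₀⟩ := hX
  let C : ℕ → Prop := fun l => ∀ x ∈ X, x₀.take l <+: x
  have h0 : C 0 := fun x _ => by simp
  refine ⟨x₀.take (Nat.findGreatest C x₀.length),
    Nat.findGreatest_spec (P := C) (Nat.zero_le _) h0, fun q hq => ?_⟩
  have hq₀ := hq x₀ hx₀
  have hqt : q = x₀.take q.length := List.prefix_iff_eq_take.1 hq₀
  have hle : q.length ≤ Nat.findGreatest C x₀.length :=
    Nat.le_findGreatest hq₀.length_le (fun x hx => hqt ▸ hq x hx)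
  rw [hqt]
  exact List.take_prefix_take_left hle

theorem exists_isLcp {T : List α → Entry β} {S : Set (List α)} {u : List α}
    (h : (rowWords T S u).Nonempty) : ∃ p, IsLcp T S u p := by
  obtain ⟨p, hp, hp'⟩ := exists_lcp h
  exact ⟨p, h, hp, hp'⟩

theorem rowWords_mono {T : List α → Entry β} {S S' : Set (List α)} (h : S ⊆ S') (u : List α) :
    rowWords T S u ⊆ rowWords T S' u :=
  fun _ ⟨v, hv, hx⟩ => ⟨v, h hv, hx⟩

theorem IsLcp.unique {T : List α → Entry β} {S : Set (List α)} {u : List α} {p q : List β}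
    (hp : IsLcp T S u p) (hq : IsLcp T S u q) : p = q :=
  (hq.2.2 p hp.2.1).eq_of_length_le (hp.2.2 q hq.2.1).length_le

open Classical in
/-- The length of the longest common prefix of a row, `⊤` if the row holds no output word. -/
noncomputable def lcpLength (T : List α → Entry β) (S : Set (List α)) (u : List α) : ℕ∞ :=
  if h : ∃ p, IsLcp T S u p then (h.choose.length : ℕ∞) else ⊤

theorem IsLcp.lcpLength_eq {T : List α → Entry β} {S : Set (List α)} {u : List α} {p : List β}
    (hp : IsLcp T S u p) : lcpLength T S u = p.length := by
  have h : ∃ p, IsLcp T S u p := ⟨p, hp⟩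
  rw [lcpLength, dif_pos h, h.choose_spec.unique hp]

/-- More columns mean more words to share a prefix. The value `⊤` for rows without words makes the
first appearance of a word a descent too. -/
theorem lcpLength_anti {T : List α → Entry β} {S S' : Set (List α)} (h : S ⊆ S') (u : List α) :
    lcpLength T S' u ≤ lcpLength T S u := by
  by_cases hp : ∃ p, IsLcp T S u p
  · obtain ⟨p, hp⟩ := hp
    obtain ⟨p', hp'⟩ := exists_isLcp (hp.1.mono (rowWords_mono h u))
    rw [hp.lcpLength_eq, hp'.lcpLength_eq]
    exact_mod_cast (hp.2.2 p' fun x hx => hp'.2.1 x (rowWords_mono h u hx)).length_le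
  · rw [lcpLength, lcpLength, dif_neg hp]
    exact le_top

/-- The new columns put `x` and `x'` into row `u`. A new prefix of the old length would equal the
old one and hence divide both, against the witness. -/
theorem LcpWitness.lcpLength_ne {T : List α → Entry β} {P S : Set (List α)} {u : List α} {a : α}
    {v v' : List α} (h : LcpWitness T P S u a v v') :
    lcpLength T (S ∪ {a :: v, a :: v'}) u ≠ lcpLength T S u := by
  intro heq
  obtain ⟨-, -, -, x, x', hx, hx', hp⟩ := h
  have hmem : x ∈ rowWords T (S ∪ {a :: v, a :: v'}) u := ⟨a :: v, by simp, by simpa using hx⟩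
  have hmem' : x' ∈ rowWords T (S ∪ {a :: v, a :: v'}) u := ⟨a :: v', by simp, by simpa using hx'⟩
  obtain ⟨q, hq⟩ := exists_isLcp ⟨x, hmem⟩
  rw [hq.lcpLength_eq] at heq
  by_cases hS : ∃ p, IsLcp T S u p
  · obtain ⟨p, hpS⟩ := hS
    rw [hpS.lcpLength_eq] at heq
    have hqp : q <+: p := hpS.2.2 q fun y hy => hq.2.1 y (rowWords_mono Set.subset_union_left u hy)
    obtain rfl : q = p := hqp.eq_of_length (by exact_mod_cast heq)
    exact hp q hpS ⟨hq.2.1 x hmem, hq.2.1 x' hmem'⟩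
  · rw [lcpLength, dif_neg hS] at heq
    exact ENat.natCast_ne_top _ heq

end Lcp

/-! ### Row equivalence up to arbitrary prefixes -/

section Rows

/-- Rows `u` and `u'` have `⊥` in the same columns of `S`, and their output words are the same up
to removal of fixed prefixes. -/
def RowSimilar (T : List α → Entry β) (S : Set (List α)) (u u' : List α) : Prop :=
  (∀ v ∈ S, T (u ++ v) = .bot ↔ T (u' ++ v) = .bot) ∧
    ∃ o o' : List β, ∀ v ∈ S,
      (∀ x, T (u ++ v) = .word x → ∃ r, x = o ++ r ∧ T (u' ++ v) = .word (o' ++ r)) ∧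
      (∀ x, T (u' ++ v) = .word x → ∃ r, x = o' ++ r ∧ T (u ++ v) = .word (o ++ r))

variable {T : List α → Entry β} {S S' : Set (List α)} {u u' : List α}

theorem RowSimilar.mono (hS : S ⊆ S') (h : RowSimilar T S' u u') : RowSimilar T S u u' := by
  obtain ⟨hb, o, o', ho⟩ := h
  exact ⟨fun v hv => hb v (hS hv), o, o', fun v hv => ho v (hS hv)⟩

theorem RowSimilar.symm (h : RowSimilar T S u u') : RowSimilar T S u' u := by
  obtain ⟨hb, o, o', ho⟩ := h
  exact ⟨fun v hv => (hb v hv).symm, o', o, fun v hv => (ho v hv).symm⟩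

theorem RowSimilar.refl (T : List α → Entry β) (S : Set (List α)) (u : List α) :
    RowSimilar T S u u :=
  ⟨fun _ _ => Iff.rfl, [], [], fun _ _ => ⟨fun x hx => ⟨x, rfl, hx⟩, fun x hx => ⟨x, rfl, hx⟩⟩⟩

theorem isLcp_append {o p : List β} {R : Set (List β)} (hne : R.Nonempty)
    (hp : ∀ r ∈ R, p <+: r) (hmax : ∀ q : List β, (∀ r ∈ R, q <+: r) → q <+: p)
    (hR : rowWords T S u = (fun r => o ++ r) '' R) : IsLcp T S u (o ++ p) := by
  refine ⟨hR ▸ hne.image _, ?_, fun q hq => ?_⟩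
  · rw [hR]
    rintro _ ⟨r, hr, rfl⟩
    exact (List.prefix_append_right_inj o).2 (hp r hr)
  · rw [hR] at hq
    obtain ⟨r₀, hr₀⟩ := hne
    -- Both `q` and `o` are prefixes of `o ++ r₀`, hence comparable.
    rcases List.prefix_or_prefix_of_prefix (hq _ ⟨r₀, hr₀, rfl⟩) (List.prefix_append o r₀)
      with h | ⟨q', rfl⟩
    · exact h.trans (List.prefix_append o p)
    · exact (List.prefix_append_right_inj o).2 (hmax q' fun r hr =>
        (List.prefix_append_right_inj o).1 (hq _ ⟨r, hr, rfl⟩))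

/-- The two rows are `o` and `o'` prepended to one set `R` of remainders, so their longest common
prefixes are `o ++ p` and `o' ++ p` with `p` that of `R`. -/
theorem RowSimilar.rowEquiv (h : RowSimilar T S u u') : RowEquiv T S u u' := by
  obtain ⟨hb, o, o', ho⟩ := h
  intro v hv
  refine ⟨hb v hv, fun hw => ?_⟩
  obtain ⟨r, hr, hr'⟩ : ∃ r, T (u ++ v) = .word (o ++ r) ∧ T (u' ++ v) = .word (o' ++ r) := by
    rcases hw with ⟨x, hx⟩ | ⟨x, hx⟩
    · obtain ⟨r, rfl, hr⟩ := (ho v hv).1 x hx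
      exact ⟨r, hx, hr⟩
    · obtain ⟨r, rfl, hr⟩ := (ho v hv).2 x hx
      exact ⟨r, hr, hx⟩
  let R : Set (List β) := {r | ∃ v ∈ S, T (u ++ v) = .word (o ++ r) ∧ T (u' ++ v) = .word (o' ++ r)}
  have hrR : r ∈ R := ⟨v, hv, hr, hr'⟩
  obtain ⟨p, hp, hmax⟩ := exists_lcp ⟨r, hrR⟩
  have hu : rowWords T S u = (fun r => o ++ r) '' R := by
    ext x
    constructor
    · rintro ⟨v, hv, hx⟩
      obtain ⟨r, rfl, hr⟩ := (ho v hv).1 x hx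
      exact ⟨r, ⟨v, hv, hx, hr⟩, rfl⟩
    · rintro ⟨r, ⟨v, hv, hx, -⟩, rfl⟩
      exact ⟨v, hv, hx⟩
  have hu' : rowWords T S u' = (fun r => o' ++ r) '' R := by
    ext x
    constructor
    · rintro ⟨v, hv, hx⟩
      obtain ⟨r, rfl, hr⟩ := (ho v hv).2 x hx
      exact ⟨r, ⟨v, hv, hr, hx⟩, rfl⟩
    · rintro ⟨r, ⟨v, hv, -, hx⟩, rfl⟩
      exact ⟨v, hv, hx⟩
  obtain ⟨s, rfl⟩ := hp r hrR
  exact ⟨o ++ p, o' ++ p, s, isLcp_append ⟨_, hrR⟩ hp hmax hu, isLcp_append ⟨_, hrR⟩ hp hmax hu',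
    by simpa using hr, by simpa using hr'⟩

theorem RowEquiv.rowSimilar (h : RowEquiv T S u u') : RowSimilar T S u u' := by
  refine ⟨fun v hv => (h v hv).1, ?_⟩
  by_cases hw : ∃ v ∈ S, (∃ x, T (u ++ v) = .word x) ∨ (∃ x, T (u' ++ v) = .word x)
  · obtain ⟨v₀, hv₀, hw₀⟩ := hw
    obtain ⟨o, o', -, ho, ho', -⟩ := (h v₀ hv₀).2 hw₀
    have key : ∀ v ∈ S, ((∃ x, T (u ++ v) = .word x) ∨ (∃ x, T (u' ++ v) = .word x)) →
        ∃ r, T (u ++ v) = .word (o ++ r) ∧ T (u' ++ v) = .word (o' ++ r) := by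
      intro v hv hw
      obtain ⟨p, p', r, hp, hp', hr, hr'⟩ := (h v hv).2 hw
      obtain rfl := hp.unique ho
      obtain rfl := hp'.unique ho'
      exact ⟨r, hr, hr'⟩
    refine ⟨o, o', fun v hv => ⟨fun x hx => ?_, fun x hx => ?_⟩⟩
    · obtain ⟨r, hr, hr'⟩ := key v hv (Or.inl ⟨x, hx⟩)
      exact ⟨r, by simpa using hx.symm.trans hr, hr'⟩
    · obtain ⟨r, hr, hr'⟩ := key v hv (Or.inr ⟨x, hx⟩)
      exact ⟨r, by simpa using hx.symm.trans hr', hr⟩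
  · push Not at hw
    exact ⟨[], [], fun v hv =>
      ⟨fun x hx => absurd hx ((hw v hv).1 x), fun x hx => absurd hx ((hw v hv).2 x)⟩⟩

/-- Not evident from the definition, since the longest common prefixes depend on the column set. The
detour through `RowSimilar`, whose prefixes are free, makes it so. -/
theorem RowEquiv.mono (hS : S ⊆ S') (h : RowEquiv T S' u u') : RowEquiv T S u u' :=
  (h.rowSimilar.mono hS).rowEquiv

theorem RowEquiv.symm (h : RowEquiv T S u u') : RowEquiv T S u' u :=
  h.rowSimilar.symm.rowEquiv

theorem RowEquiv.refl (T : List α → Entry β) (S : Set (List α)) (u : List α) :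
    RowEquiv T S u u :=
  (RowSimilar.refl T S u).rowEquiv

end Rows

/-! ### Observation tables of a target function -/

section Table

variable {Up : Language α} {τ : List α → Option (List β)}

theorem rowView_eq_word_iff {merge : Bool} {e : Entry β} {x : List β} :
    rowView merge e = .word x ↔ e = .word x := by
  cases e <;> cases merge <;> simp [rowView]

theorem observe_eq_word_iff (hUp : ∀ u, τ u ≠ none → u ∈ Up) {w : List α} {x : List β} :
    observe Up τ w = .word x ↔ τ w = some x := by
  unfold observe
  by_cases hw : w ∈ Up
  · cases h : τ w <;> simp [hw]
  · have : τ w = none := by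
      by_contra h
      exact hw (hUp w h)
    simp [hw, this]

theorem observe_eq_bot_iff {w : List α} : observe Up τ w = .bot ↔ w ∈ Up ∧ τ w = none := by
  unfold observe
  by_cases hw : w ∈ Up
  · cases h : τ w <;> simp [hw]
  · simp [hw]

theorem observe_eq_hash_iff {w : List α} : observe Up τ w = .hash ↔ w ∉ Up := by
  unfold observe
  by_cases hw : w ∈ Up
  · cases h : τ w <;> simp [hw]
  · simp [hw]

theorem rowView_observe_eq_bot_iff {merge : Bool} {w : List α} :
    rowView merge (observe Up τ w) = .bot ↔
      (w ∈ Up ∧ τ w = none) ∨ (merge = true ∧ w ∉ Up) := by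
  rw [← observe_eq_bot_iff, ← observe_eq_hash_iff]
  cases observe Up τ w <;> cases merge <;> simp [rowView]

/-- Words that lead to the same states of the target transducer and of the automaton have
equivalent rows. -/
theorem rowEquiv_of_run_eq {Q : Type*} {A : DFA α σ} {M : Transducer α β Q} {merge : Bool}
    (hUp : ∀ u, M.sem u ≠ none → u ∈ A.accepts) (S : Set (List α)) {u u' : List α}
    (hM : (M.run M.start u).map Prod.fst = (M.run M.start u').map Prod.fst)
    (hA : A.eval u = A.eval u') :
    RowEquiv (rowView merge ∘ observe A.accepts M.sem) S u u' := by
  have hmem : ∀ v, u ++ v ∈ A.accepts ↔ u' ++ v ∈ A.accepts := by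
    intro v
    simp only [DFA.mem_accepts, DFA.eval] at hA ⊢
    rw [DFA.evalFrom_of_append, DFA.evalFrom_of_append, hA]
  -- The residual function `f` depends only on the state reached; `o` and `o'` are the outputs
  -- produced on the way there.
  obtain ⟨o, o', f, hf, hf'⟩ : ∃ (o o' : List β) (f : List α → Option (List β)),
      (∀ v, M.sem (u ++ v) = (f v).map (o ++ ·)) ∧
      (∀ v, M.sem (u' ++ v) = (f v).map (o' ++ ·)) := by
    have hsem : ∀ u v q x, M.run M.start u = some (q, x) → M.sem (u ++ v) =
        ((M.run q v).bind fun r => (M.final r.1).map fun w => r.2 ++ w).map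
          ((M.init ++ x) ++ ·) := by
      intro u v q x h
      rw [Transducer.sem, Transducer.run_append, h]
      cases hr : M.run q v with
      | none => simp [hr]
      | some r => cases hfin : M.final r.1 <;> simp [hr, hfin]
    cases h : M.run M.start u with
    | none =>
      rw [h] at hM
      have h' : M.run M.start u' = none := by simpa using hM.symm
      refine ⟨[], [], fun _ => none, fun v => ?_, fun v => ?_⟩ <;>
        simp [Transducer.sem, Transducer.run_append, h, h']
    | some r =>
      rw [h] at hM
      obtain ⟨⟨q', x'⟩, h', hq⟩ := Option.map_eq_some_iff.1 hM.symm
      obtain ⟨q, x⟩ := r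
      obtain rfl : q' = q := hq
      exact ⟨_, _, _, fun v => hsem u v _ _ h, fun v => hsem u' v _ _ h'⟩
  refine RowSimilar.rowEquiv ⟨fun v _ => ?_, o, o', fun v _ => ?_⟩
  · simp only [Function.comp_apply, rowView_observe_eq_bot_iff, hmem v, hf, hf',
      Option.map_eq_none_iff]
  · simp only [Function.comp_apply, rowView_eq_word_iff, observe_eq_word_iff hUp, hf, hf',
      Option.map_eq_some_iff]
    constructor
    · rintro _ ⟨r, hr, rfl⟩
      exact ⟨r, rfl, r, hr, rfl⟩
    · rintro _ ⟨r, hr, rfl⟩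
      exact ⟨r, rfl, r, hr, rfl⟩

variable {Q : Type*} {P P' S S' : Set (List α)}

theorem Compatible.anti {T : List α → Entry β} {M : Transducer α β Q} (hP : P ⊆ P') (hS : S ⊆ S')
    (h : Compatible T P' S' M) : Compatible T P S M := by
  intro u hu v hv
  refine h u ?_ v (hS hv)
  rcases hu with hu | ⟨u₀, hu₀, a, rfl⟩
  · exact Or.inl (hP hu)
  · exact Or.inr ⟨u₀, hP hu₀, a, rfl⟩

theorem compatible_of_semOn_eq (hUp : ∀ u, τ u ≠ none → u ∈ Up) {M : Transducer α β Q}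
    (hM : M.semOn Up = τ) (P S : Set (List α)) : Compatible (observe Up τ) P S M := by
  have hsem : ∀ w ∈ Up, M.sem w = τ w := by
    intro w hw
    rw [← hM, Transducer.semOn, if_pos hw]
  intro u _ v _
  refine ⟨fun x hx => ?_, fun h => ?_⟩
  · have hx' := (observe_eq_word_iff hUp).1 hx
    rw [hsem _ (hUp _ (by simp [hx'])), hx']
  · obtain ⟨hw, h⟩ := observe_eq_bot_iff.1 h
    rw [hsem _ hw, h]

theorem Transducer.semOn_eq_of_sem_eq (hUp : ∀ u, τ u ≠ none → u ∈ Up) {M : Transducer α β Q}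
    (hM : M.sem = τ) : M.semOn Up = τ := by
  funext u
  rw [Transducer.semOn, hM]
  split_ifs with h
  · rfl
  · by_contra h'
    exact h (hUp u (Ne.symm h'))

theorem Compatible.sem_eq (hUp : ∀ u, τ u ≠ none → u ∈ Up) {M : Transducer α β Q}
    (h : Compatible (observe Up τ) P S M) (hP : [] ∈ P) {w : List α} (hS : w ∈ S) (hw : w ∈ Up) :
    M.sem w = τ w := by
  have h' := h [] (Or.inl hP) w hS
  rw [List.nil_append] at h'
  cases hτ : τ w with
  | none => exact h'.2 (observe_eq_bot_iff.2 ⟨hw, hτ⟩)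
  | some x => exact h'.1 x ((observe_eq_word_iff hUp).2 hτ)

end Table

/-! ### Invariants, progress and termination -/

section Execution

variable {A : DFA α σ} {τ : List α → Option (List β)} {merge : Bool}

theorem mem_of_prod_sem_ne {Q : Type*} (hUp : ∀ u, τ u ≠ none → u ∈ A.accepts)
    {M : Transducer α β Q} {u : List α} (h : (M.prod A).sem u ≠ τ u) :
    u ∈ A.accepts ∧ M.sem u ≠ τ u := by
  rw [Transducer.prod_sem, Transducer.semOn] at h
  by_cases hu : u ∈ A.accepts
  · exact ⟨hu, by simpa [hu] using h⟩
  · rw [if_neg hu] at h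
    exact absurd (hUp u (Ne.symm h)) hu

/-- The properties of the index sets that every iteration preserves. -/
structure Good (A : DFA α σ) (τ : List α → Option (List β)) (merge : Bool)
    (P S : Set (List α)) (k : ℕ) : Prop where
  nil_mem : [] ∈ P
  eq_of_rowEquiv : ∀ u ∈ P, ∀ u' ∈ P,
    RowEquiv (rowView merge ∘ observe A.accepts τ) S u u' → u = u'
  lt_size : ∀ (n : ℕ) (N : Transducer α β (Fin n)), Compatible (observe A.accepts τ) P S N → k < n

theorem Good.mono_right {P S S' : Set (List α)} {k : ℕ} (hS : S ⊆ S')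
    (h : Good A τ merge P S k) : Good A τ merge P S' k :=
  ⟨h.nil_mem, fun u hu u' hu' he => h.eq_of_rowEquiv u hu u' hu' (he.mono hS),
    fun n N hN => h.lt_size n N (hN.anti subset_rfl hS)⟩

theorem good_initial : Good A τ merge {[]} {[]} 0 :=
  -- The start state makes every size positive.
  ⟨rfl, fun _ hu _ hu' _ => hu.trans hu'.symm, fun _ N _ => N.start.pos⟩

theorem Good.not_equivWitness {P S : Set (List α)} {k : ℕ} (h : Good A τ merge P S k)
    {u u' : List α} {a : α} {v : List α} :
    ¬ EquivWitness (rowView merge ∘ observe A.accepts τ) P S u u' a v := by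
  rintro ⟨hu, hu', hv, he, hne⟩
  obtain rfl := h.eq_of_rowEquiv u hu u' hu' he
  exact hne (RowEquiv.refl _ _ _ v hv)

theorem Good.closure {P S : Set (List α)} {k : ℕ} (h : Good A τ merge P S k)
    {u : List α} {a : α}
    (hc : ClosureWitness (rowView merge ∘ observe A.accepts τ) P S u a) :
    Good A τ merge (P ∪ {u ++ [a]}) S k := by
  refine ⟨Or.inl h.nil_mem, ?_, fun _ N hN => h.lt_size _ N
    (hN.anti Set.subset_union_left subset_rfl)⟩
  rintro w (hw | rfl) w' (hw' | rfl) he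
  · exact h.eq_of_rowEquiv w hw w' hw' he
  · exact absurd he.symm (hc.2 w hw)
  · exact absurd he (hc.2 w' hw')
  · rfl

theorem Good.counterexample (hUp : ∀ u, τ u ≠ none → u ∈ A.accepts) {P S : Set (List α)} {k n : ℕ}
    (h : Good A τ merge P S k) {M : Transducer α β (Fin n)} {u : List α}
    (hc : ¬ ∃ w, CompetingWord A.accepts (observe A.accepts τ) P S w)
    (hM : MinCompatible (observe A.accepts τ) P S M) (hu : (M.prod A).sem u ≠ τ u) :
    Good A τ merge P (S ∪ {s | s <:+ u}) (k + 1) := by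
  obtain ⟨hmem, hne⟩ := mem_of_prod_sem_ne hUp hu
  have h' := h.mono_right (S' := S ∪ {s | s <:+ u}) Set.subset_union_left
  refine ⟨h.nil_mem, h'.eq_of_rowEquiv, fun m N hN => ?_⟩
  have hNS : Compatible (observe A.accepts τ) P S N := hN.anti subset_rfl Set.subset_union_left
  have hk := h.lt_size n M hM.1
  -- If `N` had the size of `M`, it would be minimal for the old table and differ from `M` at `u`,
  -- so `u` would be a competing word.
  rcases (hM.2 m N hNS).lt_or_eq with hlt | rfl
  · omega
  · refine absurd ⟨u, hmem, n, M, N, hM, ⟨hNS, hM.2⟩, ?_⟩ hc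
    rwa [hN.sem_eq hUp h.nil_mem (Or.inr (List.suffix_refl u)) hmem]

/-- The invariant of the execution. -/
def Invariant (A : DFA α σ) (τ : List α → Option (List β)) (merge : Bool) : Config α β → Prop
  | .loop P S k => Good A τ merge P S k
  | .halt n M k => M.semOn A.accepts = τ ∧
      ∀ (m : ℕ) (N : Transducer α β (Fin m)), N.semOn A.accepts = τ → k ≤ m

theorem Invariant.step (hUp : ∀ u, τ u ≠ none → u ∈ A.accepts) {c c' : Config α β}
    (h : Invariant A τ merge c) (hs : Step A τ merge c c') : Invariant A τ merge c' := by
  cases hs with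
  | lcp _ => exact Good.mono_right Set.subset_union_left h
  | equiv _ _ => exact Good.mono_right Set.subset_union_left h
  | closure _ _ hc => exact Good.closure h hc
  | competing _ _ => exact Good.mono_right Set.subset_union_left h
  | counterexample _ hc hM hu => exact Good.counterexample hUp h hc hM hu
  | success _ _ _ heq =>
    exact ⟨by rw [← Transducer.prod_sem, heq],
      fun m N hN => Good.lt_size h m N (compatible_of_semOn_eq hUp hN _ _)⟩

theorem invariant_of_reachable (hUp : ∀ u, τ u ≠ none → u ∈ A.accepts) {c : Config α β}
    (h : Relation.ReflTransGen (Step A τ merge) (Config.initial α β) c) :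
    Invariant A τ merge c := by
  induction h with
  | refl => exact good_initial
  | tail _ hs ih => exact ih.step hUp hs

theorem exists_step (hUp : ∀ u, τ u ≠ none → u ∈ A.accepts)
    (hτ : ∃ (n : ℕ) (M : Transducer α β (Fin n)), M.sem = τ) (P S : Set (List α)) (k : ℕ) :
    ∃ c', Step A τ merge (.loop P S k) c' := by
  classical
  by_cases h₁ : ∃ u a v v', LcpWitness (rowView merge ∘ observe A.accepts τ) P S u a v v'
  · obtain ⟨u, a, v, v', h⟩ := h₁
    exact ⟨_, .lcp h⟩
  by_cases h₂ : ∃ u u' a v, EquivWitness (rowView merge ∘ observe A.accepts τ) P S u u' a v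
  · obtain ⟨u, u', a, v, h⟩ := h₂
    exact ⟨_, .equiv h₁ h⟩
  by_cases h₃ : ∃ u a, ClosureWitness (rowView merge ∘ observe A.accepts τ) P S u a
  · obtain ⟨u, a, h⟩ := h₃
    exact ⟨_, .closure h₁ h₂ h⟩
  by_cases h₄ : ∃ w, CompetingWord A.accepts (observe A.accepts τ) P S w
  · obtain ⟨w, h⟩ := h₄
    exact ⟨_, .competing ⟨h₁, h₂, h₃⟩ h⟩
  obtain ⟨n₀, M₀, hM₀⟩ := hτ
  -- The target's own transducer is compatible, so a minimal compatible one exists.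
  have hex : ∃ n, ∃ M : Transducer α β (Fin n), Compatible (observe A.accepts τ) P S M :=
    ⟨n₀, M₀, compatible_of_semOn_eq hUp (Transducer.semOn_eq_of_sem_eq hUp hM₀) P S⟩
  obtain ⟨M, hM⟩ := Nat.find_spec hex
  have hmin : MinCompatible (observe A.accepts τ) P S M :=
    ⟨hM, fun m N hN => Nat.find_min' hex ⟨N, hN⟩⟩
  by_cases heq : (M.prod A).sem = τ
  · exact ⟨_, .success ⟨h₁, h₂, h₃⟩ h₄ hmin heq⟩
  · obtain ⟨u, hu⟩ := Function.ne_iff.1 heq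
    exact ⟨_, .counterexample ⟨h₁, h₂, h₃⟩ h₄ hmin hu⟩

/-- `w` is a word of the upper bound that refutes a minimal compatible transducer. -/
def Refutes (A : DFA α σ) (τ : List α → Option (List β)) (P S : Set (List α)) (w : List α) :
    Prop :=
  w ∈ A.accepts ∧ ∃ (n : ℕ) (M : Transducer α β (Fin n)),
    MinCompatible (observe A.accepts τ) P S M ∧ M.sem w ≠ τ w

theorem Step.progress (hUp : ∀ u, τ u ≠ none → u ∈ A.accepts) {P S P' S' : Set (List α)} {k k' : ℕ}
    (hg : Good A τ merge P S k) (hs : Step A τ merge (.loop P S k) (.loop P' S' k')) :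
    P ⊆ P' ∧ S ⊆ S' ∧
      ((∃ u ∈ P, lcpLength (rowView merge ∘ observe A.accepts τ) S' u ≠
          lcpLength (rowView merge ∘ observe A.accepts τ) S u) ∨
        (∃ u ∈ P', u ∉ P) ∨ ∃ w ∈ S', Refutes A τ P S w) := by
  cases hs with
  | lcp h => exact ⟨subset_rfl, Set.subset_union_left, Or.inl ⟨_, h.1, h.lcpLength_ne⟩⟩
  | equiv _ h => exact absurd h hg.not_equivWitness
  | @closure _ _ _ u a _ _ h =>
    exact ⟨Set.subset_union_left, subset_rfl, Or.inr (Or.inl ⟨u ++ [a], Or.inr rfl,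
      fun hmem => h.2 _ hmem (RowEquiv.refl _ _ _)⟩)⟩
  | @competing _ _ _ u _ h =>
    refine ⟨subset_rfl, Set.subset_union_left, Or.inr (Or.inr ⟨u, Or.inr (List.suffix_refl u), ?_⟩)⟩
    obtain ⟨hu, n, M₁, M₂, hM₁, hM₂, hne⟩ := h
    refine ⟨hu, n, ?_⟩
    -- Two transducers that differ at `u` cannot both be correct there.
    by_cases h₁ : M₁.sem u = τ u
    · exact ⟨M₂, hM₂, fun h₂ => hne (h₁.trans h₂.symm)⟩
    · exact ⟨M₁, hM₁, h₁⟩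
  | @counterexample _ _ _ _ M u _ _ hM h =>
    obtain ⟨hu, hne⟩ := mem_of_prod_sem_ne hUp h
    exact ⟨subset_rfl, Set.subset_union_left,
      Or.inr (Or.inr ⟨u, Or.inr (List.suffix_refl u), hu, _, M, hM, hne⟩)⟩

/-- Each refuting word enters the columns, so all later transducers are correct on it. Their sizes
are bounded by `n₀`, hence constant along an ultrafilter, where compactness applies. -/
theorem exists_not_refutes [Finite α] [Finite β] (hUp : ∀ u, τ u ≠ none → u ∈ A.accepts)
    (hτ : ∃ (n : ℕ) (M : Transducer α β (Fin n)), M.sem = τ) {P S : ℕ → Set (List α)}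
    (hnil : ∀ i, [] ∈ P i) (hS : Monotone S) :
    ¬ ∀ i, ∃ w ∈ S (i + 1), Refutes A τ (P i) (S i) w := by
  intro h
  choose w hwS hwUp n M hM hne using h
  obtain ⟨n₀, M₀, hM₀⟩ := hτ
  have hn : ∀ i, n i ∈ Set.Iic n₀ := fun i =>
    (hM i).2 n₀ M₀ (compatible_of_semOn_eq hUp (Transducer.semOn_eq_of_sem_eq hUp hM₀) _ _)
  let U : Ultrafilter ℕ := hyperfilter ℕ
  obtain ⟨m, hm⟩ := eventually_eq_const_of_finite U (Set.finite_Iic n₀) (Eventually.of_forall hn)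
  have hex : ∀ᶠ i in U, ∃ N : Transducer α β (Fin m),
      (∀ j < i, N.sem (w j) = τ (w j)) ∧ N.sem (w i) ≠ τ (w i) := by
    filter_upwards [hm] with i hi
    subst hi
    exact ⟨M i, fun j hj => (hM i).1.sem_eq hUp (hnil i) (hS hj (hwS j)) (hwUp j), hne i⟩
  obtain ⟨i, N, -⟩ := hex.exists
  have : Nonempty (Transducer α β (Fin m)) := ⟨N⟩
  obtain ⟨N, hN⟩ := hex.choice
  exact not_eventually_separated U Nat.hyperfilter_le_atTop τ w N hN

theorem eventually_lcpLength_eq (T : List α → Entry β) {S : ℕ → Set (List α)} (hS : Monotone S)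
    (u : List α) : ∀ᶠ i in atTop, lcpLength T (S (i + 1)) u = lcpLength T (S i) u := by
  have hanti : Antitone fun i => lcpLength T (S i) u := fun i j hij => lcpLength_anti (hS hij) u
  obtain ⟨N, hN⟩ := WellFoundedGT.monotone_chain_condition
    (α := ℕ∞ᵒᵈ) ⟨fun i => OrderDual.toDual (lcpLength T (S i) u), hanti⟩
  filter_upwards [eventually_ge_atTop N] with i hi
  exact (hN (i + 1) (by omega)).symm.trans (hN i hi)

theorem not_exists_infinite_execution [Finite α] [Finite β] [Finite σ]
    (hUp : ∀ u, τ u ≠ none → u ∈ A.accepts)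
    (hτ : ∃ (n : ℕ) (M : Transducer α β (Fin n)), M.sem = τ) :
    ¬ ∃ c : ℕ → Config α β, c 0 = Config.initial α β ∧ ∀ i, Step A τ merge (c i) (c (i + 1)) := by
  rintro ⟨c, hc₀, hc⟩
  have hloop : ∀ i, ∃ P S k, c i = .loop P S k := by
    intro i
    have h := hc i
    cases hci : c i with
    | loop P S k => exact ⟨P, S, k, rfl⟩
    | halt n M k =>
      rw [hci] at h
      cases h
  choose P S k hPSk using hloop
  have hreach : ∀ i, Relation.ReflTransGen (Step A τ merge) (Config.initial α β) (c i) := by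
    intro i
    induction i with
    | zero => rw [hc₀]
    | succ i ih => exact ih.tail (hc i)
  have hgood : ∀ i, Good A τ merge (P i) (S i) (k i) := by
    intro i
    have h := invariant_of_reachable hUp (hreach i)
    rwa [hPSk i] at h
  have hprog := fun i => Step.progress hUp (hgood i) (by
    have h := hc i
    rwa [hPSk i, hPSk (i + 1)] at h)
  have hPmono : Monotone P := monotone_nat_of_le_succ fun i => (hprog i).1
  have hSmono : Monotone S := monotone_nat_of_le_succ fun i => (hprog i).2.1
  have hfin : (⋃ i, P i).Finite := by
    obtain ⟨n, M, rfl⟩ := hτ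
    -- The pair of states reached is injective on the union: two words of it lie in a common `P i`,
    -- where equal pairs give equivalent rows.
    refine Set.Finite.of_finite_image (f := fun u => ((M.run M.start u).map Prod.fst, A.eval u))
      (Set.toFinite _) ?_
    rintro u hu u' hu' he
    obtain ⟨i, hi⟩ := Set.mem_iUnion.1 hu
    obtain ⟨j, hj⟩ := Set.mem_iUnion.1 hu'
    obtain ⟨he₁, he₂⟩ := Prod.ext_iff.1 he
    exact (hgood (max i j)).eq_of_rowEquiv u (hPmono (le_max_left i j) hi) u'
      (hPmono (le_max_right i j) hj) (rowEquiv_of_run_eq hUp _ he₁ he₂)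
  have hev₁ : ∀ᶠ i in atTop, ∀ u ∈ ⋃ i, P i, u ∈ P i := by
    refine (eventually_all_finite hfin).2 fun u hu => ?_
    obtain ⟨j, hj⟩ := Set.mem_iUnion.1 hu
    filter_upwards [eventually_ge_atTop j] with i hi
    exact hPmono hi hj
  have hev₂ := (eventually_all_finite hfin).2 fun u _ =>
    eventually_lcpLength_eq (rowView merge ∘ observe A.accepts τ) hSmono u
  obtain ⟨N, hN⟩ := eventually_atTop.1 (hev₁.and hev₂)
  -- After stage `N` neither `P` nor any prefix length changes, so refutation is the only progress
  -- left.
  refine exists_not_refutes (P := fun i => P (N + i)) (S := fun i => S (N + i)) hUp hτ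
    (fun i => (hgood _).nil_mem) (fun i j hij => hSmono (by omega)) fun i => ?_
  obtain ⟨h₁, h₂⟩ := hN (N + i) (by omega)
  rcases (hprog (N + i)).2.2 with ⟨u, hu, h⟩ | ⟨u, hu, h⟩ | h
  · exact absurd (h₂ u (Set.mem_iUnion.2 ⟨_, hu⟩)) h
  · exact absurd (h₁ u (Set.mem_iUnion.2 ⟨_, hu⟩)) h
  · exact h

end Execution

end Graybox

theorem theorem1 {α β σ : Type*} [Finite α] [Finite β] [Finite σ]
    (A : DFA α σ) (τ : List α → Option (List β))
    (hτ : ∃ (n : ℕ) (M : Graybox.Transducer α β (Fin n)), M.sem = τ)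
    (hUp : ∀ u : List α, τ u ≠ none → u ∈ A.accepts)
    (merge : Bool) :
    -- every execution is finite
    (¬ ∃ c : ℕ → Graybox.Config α β, c 0 = Graybox.Config.initial α β ∧
      ∀ i, Graybox.Step A τ merge (c i) (c (i + 1))) ∧
    -- an execution can stop only by returning a transducer, and this one is correct on `Up`
    (∀ c : Graybox.Config α β,
      Relation.ReflTransGen (Graybox.Step A τ merge) (Graybox.Config.initial α β) c →
      (¬ ∃ c', Graybox.Step A τ merge c c') →
      ∃ (n : ℕ) (M : Graybox.Transducer α β (Fin n)) (k : ℕ),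
        c = .halt n M k ∧ M.semOn A.accepts = τ) ∧
    -- the bound on the number of equivalence queries
    (∀ c : Graybox.Config α β,
      Relation.ReflTransGen (Graybox.Step A τ merge) (Graybox.Config.initial α β) c →
      ∀ (n : ℕ) (M : Graybox.Transducer α β (Fin n)),
        M.semOn A.accepts = τ → c.queries ≤ n) := by
  refine ⟨Graybox.not_exists_infinite_execution hUp hτ, fun c hc hstuck => ?_,
    fun c hc n M hM => ?_⟩
  · have hinv := Graybox.invariant_of_reachable hUp hc
    cases c with
    | loop P S k => exact absurd (Graybox.exists_step hUp hτ P S k) hstuck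
    | halt n M k => exact ⟨n, M, k, rfl, hinv.1⟩
  · have hinv := Graybox.invariant_of_reachable hUp hc
    cases c with
    | loop P S k => exact (hinv.lt_size n M (Graybox.compatible_of_semOn_eq hUp hM P S)).le
    | halt n' M' k => exact hinv.2 n M hM
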